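/- Let $b\in\mathbb{C}$ with $\operatorname{Re} b>-\tfrac12$, let $\mathbb{T}=\{z\in\mathbb{C}:|z|=1\}$ be positively oriented, and let $$\nu(z)=(-z)^{-\overline b}(1-z)^{b+\overline b},\qquad z\in\mathbb{T}\setminus\{1\},$$ (principal powers) be the modified Jacobi weight. With $b=\lambda+\mathrm i\eta$ one has $\nu(e^{\mathrm i\theta})=e^{-\eta(\theta-\pi)}\,(2\sin(\theta/2))^{2\lambda}>0$ for $0<\theta<2\pi$. There is exactly one sequence $(\Phi_n)_{n\ge0}$ of monic polynomials with $\deg\Phi_n=n$ and $$\int_{\mathbb{T}}\Phi_n(z)\overline{\Phi_m(z)}\,\frac{\nu(z)}{\mathrm i z}\,dz=\kappa_n^{-2}\delta_{n,m},\qquad \kappa_n>0,\quad n,m\ge0 .$$ For $n\ge1$ let $\Phi_{n-1}^*$ be the reciprocal polynomial, $\Phi_{n-1}^*(z)=z^{n-1}\overline{\Phi_{n-1}(1/\overline z)}$, and for $z\in\mathbb{C}\setminus\mathbb{T}$ put $$G_n(z)=\frac1{2\pi\mathrm i}\int_{\mathbb{T}}\frac{\Phi_n(t)}{t-z}\,\frac{\nu(t)}{t^n}\,dt,\qquad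 G_{n-1}^*(z)=\frac1{2\pi\mathrm i}\int_{\mathbb{T}}\frac{\Phi_{n-1}^*(t)}{t-z}\,\frac{\nu(t)}{t^n}\,dt .$$ Then, for every $n\ge1$, the functions $G_n$ and $G_{n-1}^*$ are holomorphic on $\mathbb{C}\setminus\mathbb{T}$, and the following hypergeometric differential equations hold, the first and the third for all $z\in\mathbb{C}$, the second and the fourth for all $z\in\mathbb{C}\setminus\mathbb{T}$: $$z(1-z)\Phi_n''(z)+[(n-b-2)z+(1-n-\overline b)]\,\Phi_n'(z)+n(1+b)\,\Phi_n(z)=0,$$ $$z(1-z)G_n''(z)+[(b-n-2)z+(1+n+\overline b)]\,G_n'(z)+b(1+n)\,G_n(z)=0,$$ $$z(1-z)(\Phi_{n-1}^*)''(z)+[(n-b-2)z+(1-n-\overline b)]\,(\Phi_{n-1}^*)'(z)+b(n-1)\,\Phi_{n-1}^*(z)=0,$$ $$z(1-z)(G_{n-1}^*)''(z)+[(b-n-2)z+(1+n+\overline b)]\,(G_{n-1}^*)'(z)+n(b-1)\,G_{n-1}^*(z)=0.$$ -/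

import Mathlib

open Polynomial ComplexConjugate

noncomputable section

/-- The modified Jacobi weight `ν(z) = (-z)^(-b̄) (1-z)^(b+b̄)` on the unit circle, with principal
powers. At `z = exp(iθ)`, `0 < θ < 2π`, `b = λ + iη`, it equals
`exp(-η(θ-π)) (2 sin(θ/2))^(2λ) > 0`. -/
def jacobiWeight (b z : ℂ) : ℂ :=
  (-z) ^ (-conj b) * (1 - z) ^ (b + conj b)

/-- `Φ` is the sequence of monic orthogonal polynomials on the unit circle for the measure
`dμ(z) = ν(z) / (i z) dz`: `Φ n` is monic of degree `n` and
`∫ Φ_n conj(Φ_m) dμ = κ_n⁻² δ_{n,m}` with `κ_n > 0`. -/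
structure IsMonicOrthogonalSequence (ν : ℂ → ℂ) (Φ : ℕ → ℂ[X]) : Prop where
  monic : ∀ n, (Φ n).Monic
  natDegree_eq : ∀ n, (Φ n).natDegree = n
  orthogonal : ∃ κ : ℕ → ℝ, (∀ n, 0 < κ n) ∧ ∀ n m,
    (∮ z in C(0, 1), (Φ n).eval z * conj ((Φ m).eval z) * (ν z / (Complex.I * z))) =
      if n = m then ((κ n : ℂ) ^ 2)⁻¹ else 0

/-- The reciprocal polynomial `p^*(z) = z^n conj(p(1/z̄))` of a polynomial of degree at most `n`. -/
def reciprocalPoly (n : ℕ) (p : ℂ[X]) : ℂ[X] :=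
  (p.reflect n).map (starRingEnd ℂ)

theorem eval_reciprocalPoly (n : ℕ) (p : ℂ[X]) (hp : p.natDegree ≤ n) (z : ℂ) (hz : z ≠ 0) :
    (reciprocalPoly n p).eval z = z ^ n * conj (p.eval (1 / conj z)) := by
  have hz' : conj z ≠ 0 := (_root_.map_ne_zero _).2 hz
  let _ : Invertible (conj z)⁻¹ := ⟨conj z, mul_inv_cancel₀ hz', inv_mul_cancel₀ hz'⟩
  have h := eval₂_reflect_mul_pow (RingHom.id ℂ) (conj z)⁻¹ n p hp
  have h2 : (p.reflect n).eval (conj z) = (conj z) ^ n * p.eval (1 / conj z) := by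
    rw [eval₂_id, eval₂_id] at h
    change (p.reflect n).eval (conj z) * _ = _ at h
    rw [one_div, ← h, mul_left_comm, ← mul_pow, mul_inv_cancel₀ hz', one_pow, mul_one]
  have h3 : (reciprocalPoly n p).eval z = conj ((p.reflect n).eval (conj z)) := by
    rw [reciprocalPoly, eval_map, ← eval₂_at_apply, Complex.conj_conj]
  rw [h3, h2]
  simp

/-- The Cauchy-type integral `(2πi)⁻¹ ∫_𝕋 p(t) / (t - z) · ν(t) / t^n dt`. -/
def associatedFunction (ν : ℂ → ℂ) (n : ℕ) (p : ℂ[X]) (z : ℂ) : ℂ :=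
  (2 * (Real.pi : ℂ) * Complex.I)⁻¹ * ∮ t in C(0, 1), p.eval t / (t - z) * (ν t / t ^ n)

end

/-! Everything rests on a Pearson equation. On the circle the weight `w(θ)` satisfies (1 - z) w' =
-i (b z + b̄) w, and (1 - z) w vanishes at z = 1 because Re b > -1/2. Integrating a derivative of (1
- z) w h therefore leaves no boundary term, which gives the identity `weightedIntegral_pearson`.

Polynomials: the hypergeometric operator lowers the degree of Φ_n, since its action on the leading
coefficient cancels. By the Pearson identity it also keeps Φ_n orthogonal to 1, z, ..., z^(n-1). The
image is then orthogonal to itself, hence zero. On coefficients the equation is a two-term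
recurrence, so reversing and conjugating coefficients turns it into the equation for the reciprocal
polynomial.

Cauchy integrals: applying the dual operator in z to the kernel 1/(t - z) gives, modulo the equation
of p in t, a total derivative of Pearson type (a Lagrange identity), whose integral vanishes.
Differentiation under the integral finishes the argument. -/

noncomputable section

/-! ### The weight in the angular variable -/

/-- The modified Jacobi weight as a function of the angle `θ`. -/
def angularWeight (b : ℂ) (θ : ℝ) : ℝ :=
  Real.exp (-b.im * (θ - Real.pi)) * (2 * Real.sin (θ / 2)) ^ (2 * b.re)

theorem conj_eq_re_sub_im_mul_I (b : ℂ) : conj b = b.re - b.im * Complex.I := by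
  apply Complex.ext <;> simp

theorem sin_half_pos {θ : ℝ} (hθ : θ ∈ Set.Ioo 0 (2 * Real.pi)) : 0 < Real.sin (θ / 2) :=
  Real.sin_pos_of_pos_of_lt_pi (by linarith [hθ.1]) (by linarith [hθ.2])

theorem angularWeight_pos (b : ℂ) {θ : ℝ} (hθ : θ ∈ Set.Ioo 0 (2 * Real.pi)) :
    0 < angularWeight b θ :=
  mul_pos (Real.exp_pos _) (Real.rpow_pos_of_pos (mul_pos two_pos (sin_half_pos hθ)) _)

/-- The polar form of 1 - z: its argument (θ - π)/2 lies in (-π/2, π/2) for 0 < θ < 2π, so the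
principal logarithm can be read off. -/
theorem one_sub_circleMap (θ : ℝ) :
    1 - circleMap 0 1 θ =
      (2 * Real.sin (θ / 2) : ℝ) * Complex.exp ((θ - Real.pi) / 2 * Complex.I) := by
  have h1 : Complex.exp ((θ - Real.pi) / 2 * Complex.I) =
      -Complex.I * Complex.exp (θ / 2 * Complex.I) := by
    rw [show ((θ : ℂ) - Real.pi) / 2 * Complex.I =
      θ / 2 * Complex.I + -(Real.pi / 2 * Complex.I) by ring, Complex.exp_add, Complex.exp_neg,
      Complex.exp_pi_div_two_mul_I, Complex.inv_I]
    ring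
  rw [h1]
  push_cast
  rw [Complex.sin, circleMap_zero]
  have h2 : Complex.exp (θ * Complex.I) = Complex.exp (θ / 2 * Complex.I) ^ 2 := by
    rw [← Complex.exp_nat_mul]; congr 1; push_cast; ring
  have h3 : Complex.exp (-(θ / 2) * Complex.I) * Complex.exp (θ / 2 * Complex.I) = 1 := by
    rw [← Complex.exp_add]; simp
  rw [h2]
  push_cast
  linear_combination Complex.I ^ 2 * h3 +
    (1 - Complex.exp (θ / 2 * Complex.I) ^ 2) * Complex.I_sq

theorem jacobiWeight_circleMap (b : ℂ) {θ : ℝ} (hθ : θ ∈ Set.Ioo 0 (2 * Real.pi)) :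
    jacobiWeight b (circleMap 0 1 θ) = angularWeight b θ := by
  have hs := mul_pos two_pos (sin_half_pos hθ)
  have hπ := Real.pi_pos
  obtain ⟨h0, h1⟩ := hθ
  have hneg : -circleMap 0 1 θ = Complex.exp ((θ - Real.pi) * Complex.I) := by
    rw [sub_mul, Complex.exp_sub, Complex.exp_pi_mul_I, circleMap_zero]; simp [div_neg]
  have hlog1 : Complex.log (Complex.exp ((θ - Real.pi) * Complex.I)) =
      (θ - Real.pi) * Complex.I :=
    Complex.log_exp (by simp; linarith) (by simp; linarith)
  have hlog2 : Complex.log (Complex.exp ((θ - Real.pi) / 2 * Complex.I)) =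
      (θ - Real.pi) / 2 * Complex.I := by
    apply Complex.log_exp <;>
    · rw [show ((θ : ℂ) - Real.pi) / 2 = ((θ - Real.pi) / 2 : ℝ) by push_cast; rfl]
      simp
      linarith
  rw [jacobiWeight, angularWeight, hneg, one_sub_circleMap,
    Complex.cpow_def_of_ne_zero (Complex.exp_ne_zero _),
    Complex.cpow_def_of_ne_zero
      (mul_ne_zero (Complex.ofReal_ne_zero.2 hs.ne') (Complex.exp_ne_zero _)),
    Complex.log_ofReal_mul hs (Complex.exp_ne_zero _), hlog1, hlog2,
    Real.rpow_def_of_pos hs, ← Real.exp_add, ← Complex.exp_add, Complex.ofReal_exp]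
  congr 1
  have hb : b = b.re + b.im * Complex.I := (Complex.re_add_im b).symm
  rw [conj_eq_re_sub_im_mul_I]
  nth_rewrite 3 [hb]
  push_cast
  linear_combination (b.im * ((θ : ℂ) - Real.pi)) * Complex.I_sq

/-- For negative r, Jordan's inequality 2 sin(θ/2) ≥ 2θ/π on [0, π] gives domination by a multiple
of θ^r. The reflection θ ↦ 2π - θ handles the other half. -/
theorem intervalIntegrable_two_mul_sin_half_rpow {r : ℝ} (hr : -1 < r) :
    IntervalIntegrable (fun θ ↦ (2 * Real.sin (θ / 2)) ^ r) MeasureTheory.volume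
      0 (2 * Real.pi) := by
  have hπ := Real.pi_pos
  rcases le_or_gt 0 r with h | h
  · refine Continuous.intervalIntegrable ?_ _ _
    exact Continuous.rpow_const (by fun_prop) fun _ ↦ Or.inr h
  have hcont : ContinuousOn (fun θ ↦ (2 * Real.sin (θ / 2)) ^ r) (Set.Ioo 0 (2 * Real.pi)) := by
    refine ContinuousOn.rpow_const (by fun_prop) fun x hx ↦ ?_
    exact Or.inl (mul_pos two_pos (sin_half_pos hx)).ne'
  have half : IntervalIntegrable (fun θ ↦ (2 * Real.sin (θ / 2)) ^ r) MeasureTheory.volume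
      0 Real.pi := by
    have hbound : IntervalIntegrable (fun x : ℝ ↦ (2 / Real.pi) ^ r * x ^ r)
        MeasureTheory.volume 0 Real.pi :=
      (intervalIntegral.intervalIntegrable_rpow' hr).const_mul _
    refine hbound.mono_fun ?_ ?_
    · rw [Set.uIoc_of_le hπ.le]
      exact (hcont.mono fun x hx ↦ ⟨hx.1, by linarith [hx.2]⟩).aestronglyMeasurable
        measurableSet_Ioc
    · rw [Set.uIoc_of_le hπ.le]
      filter_upwards [MeasureTheory.ae_restrict_mem measurableSet_Ioc] with x hx
      have hx0 : 0 < x := hx.1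
      have hs := Real.mul_le_sin (x := x / 2) (by linarith) (by linarith [hx.2])
      have hs' : 2 / Real.pi * x ≤ 2 * Real.sin (x / 2) := by linarith
      have hp : 0 < 2 / Real.pi * x := by positivity
      rw [← Real.mul_rpow (by positivity) hx0.le,
        Real.norm_of_nonneg (Real.rpow_nonneg (hp.le.trans hs') _),
        Real.norm_of_nonneg (Real.rpow_nonneg hp.le _)]
      exact Real.rpow_le_rpow_of_nonpos hp hs' h.le
  have half' := (half.comp_sub_left (2 * Real.pi)).symm
  refine half.trans (b := Real.pi) ?_
  convert half' using 1
  · ext θ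
    rw [show (2 * Real.pi - θ) / 2 = Real.pi - θ / 2 by ring, Real.sin_pi_sub]
  · ring
  · ring

theorem intervalIntegrable_angularWeight {b : ℂ} (hb : -1 / 2 < b.re) :
    IntervalIntegrable (angularWeight b) MeasureTheory.volume 0 (2 * Real.pi) :=
  (intervalIntegrable_two_mul_sin_half_rpow (r := 2 * b.re) (by linarith)).continuousOn_mul
    (by fun_prop)

theorem hasDerivAt_angularWeight (b : ℂ) {θ : ℝ} (hθ : θ ∈ Set.Ioo 0 (2 * Real.pi)) :
    HasDerivAt (angularWeight b)
      (angularWeight b θ * (-b.im + b.re * (Real.cos (θ / 2) / Real.sin (θ / 2)))) θ := by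
  have hs := sin_half_pos hθ
  have h1 : HasDerivAt (fun x : ℝ ↦ Real.exp (-b.im * (x - Real.pi)))
      (Real.exp (-b.im * (θ - Real.pi)) * -b.im) θ := by
    have := (((hasDerivAt_id θ).sub_const Real.pi).const_mul (-b.im)).exp
    simpa using this
  have h2 : HasDerivAt (fun x : ℝ ↦ 2 * Real.sin (x / 2)) (Real.cos (θ / 2)) θ := by
    have := (((hasDerivAt_id θ).div_const 2).sin).const_mul 2
    exact this.congr_deriv (by simp only [id]; ring)
  have h3 := h2.rpow_const (p := 2 * b.re) (Or.inl (by positivity))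
  refine (h1.mul h3).congr_deriv ?_
  rw [angularWeight, Real.rpow_sub_one (by positivity)]
  field_simp

/-- The Pearson equation: (1 - z) cot(θ/2) = -i (z + 1), so the factor 1 - z clears the pole of the
logarithmic derivative at z = 1. -/
theorem one_sub_circleMap_mul_deriv_log (b : ℂ) {θ : ℝ} (hθ : θ ∈ Set.Ioo 0 (2 * Real.pi)) :
    (1 - circleMap 0 1 θ) *
        ((-b.im + b.re * (Real.cos (θ / 2) / Real.sin (θ / 2)) : ℝ) : ℂ) =
      -Complex.I * (b * circleMap 0 1 θ + conj b) := by
  have hs : (Real.sin (θ / 2) : ℂ) ≠ 0 := Complex.ofReal_ne_zero.2 (sin_half_pos hθ).ne'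
  have hcot : (1 - circleMap 0 1 θ) * Real.cos (θ / 2) =
      -Complex.I * (circleMap 0 1 θ + 1) * Real.sin (θ / 2) := by
    have h2 : circleMap 0 1 θ = Complex.exp (θ / 2 * Complex.I) ^ 2 := by
      rw [circleMap_zero, ← Complex.exp_nat_mul]; push_cast; rw [one_mul]; congr 1; ring
    rw [h2, Complex.exp_mul_I]
    push_cast
    generalize (θ : ℂ) / 2 = x
    linear_combination (Complex.cos x * Complex.sin x ^ 2 + Complex.sin x ^ 3 * Complex.I) *
      Complex.I_sq - (Complex.cos x + Complex.sin x * Complex.I) * Complex.sin_sq_add_cos_sq x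
  have hb : b = b.re + b.im * Complex.I := (Complex.re_add_im b).symm
  rw [conj_eq_re_sub_im_mul_I]
  nth_rewrite 3 [hb]
  push_cast at hcot hs ⊢
  field_simp
  linear_combination (b.re : ℂ) * hcot + (circleMap 0 1 θ - 1) * Complex.sin ((θ : ℂ) / 2) *
    b.im * Complex.I_sq

/-! ### Weighted integrals and integration by parts -/

/-- The integral of `f` over the unit circle against the measure `ν(z) / (i z) dz`. -/
def weightedIntegral (b : ℂ) (f : ℂ → ℂ) : ℂ :=
  ∫ θ in (0 : ℝ)..2 * Real.pi, f (circleMap 0 1 θ) * angularWeight b θ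

theorem circleMap_mem_unitSphere (θ : ℝ) : circleMap 0 1 θ ∈ Metric.sphere (0 : ℂ) 1 :=
  circleMap_mem_sphere 0 zero_le_one θ

theorem ContinuousOn.comp_unitCircleMap {f : ℂ → ℂ} (hf : ContinuousOn f (Metric.sphere 0 1)) :
    Continuous fun θ ↦ f (circleMap 0 1 θ) :=
  hf.comp_continuous (continuous_circleMap 0 1) circleMap_mem_unitSphere

theorem intervalIntegrable_mul_angularWeight {b : ℂ} (hb : -1 / 2 < b.re) {f : ℂ → ℂ}
    (hf : ContinuousOn f (Metric.sphere 0 1)) :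
    IntervalIntegrable (fun θ ↦ f (circleMap 0 1 θ) * angularWeight b θ) MeasureTheory.volume
      0 (2 * Real.pi) :=
  IntervalIntegrable.continuousOn_mul
    (f := fun θ ↦ (angularWeight b θ : ℂ))
    ⟨(intervalIntegrable_angularWeight hb).1.ofReal, (intervalIntegrable_angularWeight hb).2.ofReal⟩
    hf.comp_unitCircleMap.continuousOn

theorem circleIntegral_mul_jacobiWeight (b : ℂ) (f : ℂ → ℂ) :
    (∮ z in C(0, 1), f z * jacobiWeight b z) =
      weightedIntegral b fun z ↦ Complex.I * z * f z := by
  rw [circleIntegral, weightedIntegral]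
  refine intervalIntegral.integral_congr_ae ?_
  -- The endpoint θ = 2π corresponds to z = 1, where the angular formula for the weight is not
  -- available.
  have h : ∀ᵐ x : ℝ, x ≠ 2 * Real.pi := by simp [MeasureTheory.ae_iff]
  filter_upwards [h] with x hx hmem
  rw [Set.uIoc_of_le Real.two_pi_pos.le] at hmem
  rw [deriv_circleMap, jacobiWeight_circleMap b ⟨hmem.1, lt_of_le_of_ne hmem.2 hx⟩, smul_eq_mul]
  ring

theorem weightedIntegral_congr (b : ℂ) {f g : ℂ → ℂ}
    (h : Set.EqOn f g (Metric.sphere 0 1)) : weightedIntegral b f = weightedIntegral b g := by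
  unfold weightedIntegral
  congr 1
  ext θ
  rw [h (circleMap_mem_unitSphere θ)]

theorem weightedIntegral_add {b : ℂ} (hb : -1 / 2 < b.re) {f g : ℂ → ℂ}
    (hf : ContinuousOn f (Metric.sphere 0 1)) (hg : ContinuousOn g (Metric.sphere 0 1)) :
    weightedIntegral b (fun z ↦ f z + g z) = weightedIntegral b f + weightedIntegral b g := by
  unfold weightedIntegral
  rw [← intervalIntegral.integral_add (intervalIntegrable_mul_angularWeight hb hf)
    (intervalIntegrable_mul_angularWeight hb hg)]
  simp only [add_mul]

theorem weightedIntegral_const_mul (b c : ℂ) (f : ℂ → ℂ) :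
    weightedIntegral b (fun z ↦ c * f z) = c * weightedIntegral b f := by
  unfold weightedIntegral
  rw [← intervalIntegral.integral_const_mul]
  simp only [mul_assoc]

theorem weightedIntegral_const_mul_add_add {b : ℂ} (hb : -1 / 2 < b.re) (c₁ c₂ c₃ : ℂ)
    {f₁ f₂ f₃ : ℂ → ℂ} (h₁ : ContinuousOn f₁ (Metric.sphere 0 1))
    (h₂ : ContinuousOn f₂ (Metric.sphere 0 1)) (h₃ : ContinuousOn f₃ (Metric.sphere 0 1)) :
    weightedIntegral b (fun z ↦ c₁ * f₁ z + c₂ * f₂ z + c₃ * f₃ z) =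
      c₁ * weightedIntegral b f₁ + c₂ * weightedIntegral b f₂ + c₃ * weightedIntegral b f₃ := by
  rw [weightedIntegral_add hb (by fun_prop) (by fun_prop),
    weightedIntegral_add hb (by fun_prop) (by fun_prop), weightedIntegral_const_mul,
    weightedIntegral_const_mul, weightedIntegral_const_mul]

theorem weightedIntegral_conj (b : ℂ) (f : ℂ → ℂ) :
    weightedIntegral b (fun z ↦ conj (f z)) = conj (weightedIntegral b f) := by
  unfold weightedIntegral
  rw [intervalIntegral.integral_of_le Real.two_pi_pos.le,
    intervalIntegral.integral_of_le Real.two_pi_pos.le, ← integral_conj]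
  simp

/-- The factor 1 - z raises the exponent of 2 sin(θ/2) to 2 Re b + 1 > 0, which gives continuity up
to the endpoints. -/
theorem continuousOn_one_sub_circleMap_mul_angularWeight {b : ℂ} (hb : -1 / 2 < b.re) :
    ContinuousOn (fun θ : ℝ ↦ (1 - circleMap 0 1 θ) * angularWeight b θ)
      (Set.Icc 0 (2 * Real.pi)) := by
  have hcont : Continuous fun θ : ℝ ↦ Complex.exp ((θ - Real.pi) / 2 * Complex.I) *
      ((Real.exp (-b.im * (θ - Real.pi)) * (2 * Real.sin (θ / 2)) ^ (2 * b.re + 1) : ℝ) : ℂ) := by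
    refine Continuous.mul (by fun_prop) (Complex.continuous_ofReal.comp ?_)
    refine Continuous.mul (by fun_prop) (Continuous.rpow_const (by fun_prop) fun _ ↦ Or.inr ?_)
    linarith
  refine hcont.continuousOn.congr fun θ hθ ↦ ?_
  have hs : 0 ≤ Real.sin (θ / 2) :=
    Real.sin_nonneg_of_nonneg_of_le_pi (by linarith [hθ.1]) (by linarith [hθ.2])
  simp only []
  rw [one_sub_circleMap, angularWeight, Real.rpow_add_one' (by positivity) (by linarith)]
  push_cast
  ring

/-- Integration by parts on the circle for the Jacobi weight. -/
theorem weightedIntegral_pearson {b : ℂ} (hb : -1 / 2 < b.re) {h h' : ℂ → ℂ}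
    (hd : ∀ z ∈ Metric.sphere (0 : ℂ) 1, HasDerivAt h (h' z) z)
    (hc : ContinuousOn h' (Metric.sphere 0 1)) :
    weightedIntegral b (fun z ↦ z * (1 - z) * h' z - z * h z - (b * z + conj b) * h z) = 0 := by
  have hcont : ContinuousOn h (Metric.sphere 0 1) :=
    fun z hz ↦ (hd z hz).continuousAt.continuousWithinAt
  set k : ℂ → ℂ := fun z ↦
    Complex.I * (z * (1 - z) * h' z - z * h z - (b * z + conj b) * h z) with hk
  have hkc : ContinuousOn k (Metric.sphere 0 1) := by
    rw [hk]; fun_prop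
  have key := intervalIntegral.integral_eq_sub_of_hasDerivAt_of_le
    (f := fun θ : ℝ ↦ (1 - circleMap 0 1 θ) * angularWeight b θ * h (circleMap 0 1 θ))
    (f' := fun θ : ℝ ↦ k (circleMap 0 1 θ) * angularWeight b θ)
    Real.two_pi_pos.le
    ((continuousOn_one_sub_circleMap_mul_angularWeight hb).mul
      hcont.comp_unitCircleMap.continuousOn) ?_ (intervalIntegrable_mul_angularWeight hb hkc)
  · have hzero : weightedIntegral b k = 0 := by
      -- Both boundary terms vanish because 1 - z = 0 at θ = 0 and θ = 2π.
      rw [weightedIntegral, key]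
      simp [circleMap]
    rw [hk, weightedIntegral_const_mul] at hzero
    exact (mul_eq_zero.1 hzero).resolve_left Complex.I_ne_zero
  · intro θ hθ
    have d1 := hasDerivAt_circleMap 0 1 θ
    have d2 := (hasDerivAt_angularWeight b hθ).ofReal_comp
    have d3 := (hd _ (circleMap_mem_unitSphere θ)).comp θ d1
    have d := ((d1.const_sub 1).mul d2).mul d3
    refine d.congr_deriv ?_
    have hl := one_sub_circleMap_mul_deriv_log b hθ
    push_cast at hl ⊢
    simp only [hk, Function.comp, Pi.mul_apply]
    linear_combination (angularWeight b θ * h (circleMap 0 1 θ)) * hl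

/-! ### The inner product and the orthogonal polynomials -/

theorem ne_zero_of_mem_unitSphere {z : ℂ} (hz : z ∈ Metric.sphere (0 : ℂ) 1) : z ≠ 0 :=
  ne_zero_of_mem_unit_sphere ⟨z, hz⟩

theorem conj_eq_inv_of_mem_unitSphere {z : ℂ} (hz : z ∈ Metric.sphere (0 : ℂ) 1) :
    conj z = z⁻¹ :=
  (Complex.inv_eq_conj (by simpa using hz)).symm

/-- The inner product of two polynomials in the space `L²` of the Jacobi weight, linear in the
first argument. -/
def polyInner (b : ℂ) (p q : ℂ[X]) : ℂ :=
  weightedIntegral b fun z ↦ p.eval z * conj (q.eval z)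

theorem continuousOn_eval_mul_conj_eval (p q : ℂ[X]) (s : Set ℂ) :
    ContinuousOn (fun z ↦ p.eval z * conj (q.eval z)) s :=
  (p.continuous.mul (Complex.continuous_conj.comp q.continuous)).continuousOn

theorem circleIntegral_eq_polyInner (b : ℂ) (p q : ℂ[X]) :
    (∮ z in C(0, 1), p.eval z * conj (q.eval z) * (jacobiWeight b z / (Complex.I * z))) =
      polyInner b p q := by
  have h : ∀ z, p.eval z * conj (q.eval z) * (jacobiWeight b z / (Complex.I * z)) =
      p.eval z * conj (q.eval z) / (Complex.I * z) * jacobiWeight b z := fun z ↦ by ring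
  simp_rw [h]
  rw [circleIntegral_mul_jacobiWeight]
  refine weightedIntegral_congr b fun z hz ↦ ?_
  have hz0 := ne_zero_of_mem_unitSphere hz
  change Complex.I * z * (p.eval z * conj (q.eval z) / (Complex.I * z)) = _
  rw [mul_div_cancel₀ _ (mul_ne_zero Complex.I_ne_zero hz0)]

theorem polyInner_conj_symm (b : ℂ) (p q : ℂ[X]) :
    conj (polyInner b p q) = polyInner b q p := by
  rw [polyInner, ← weightedIntegral_conj]
  refine weightedIntegral_congr b fun z _ ↦ ?_
  simp [mul_comm]

theorem polyInner_add_left {b : ℂ} (hb : -1 / 2 < b.re) (p q r : ℂ[X]) :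
    polyInner b (p + q) r = polyInner b p r + polyInner b q r := by
  rw [polyInner, polyInner, polyInner, ← weightedIntegral_add hb
    (continuousOn_eval_mul_conj_eval _ _ _) (continuousOn_eval_mul_conj_eval _ _ _)]
  simp only [eval_add, add_mul]

theorem polyInner_smul_left (b c : ℂ) (p q : ℂ[X]) :
    polyInner b (c • p) q = c * polyInner b p q := by
  rw [polyInner, polyInner, ← weightedIntegral_const_mul]
  simp only [eval_smul, smul_eq_mul, mul_assoc]

/-- The map `p ↦ ⟨p, q⟩` as a linear functional. -/
def polyInnerLeft {b : ℂ} (hb : -1 / 2 < b.re) (q : ℂ[X]) : ℂ[X] →ₗ[ℂ] ℂ where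
  toFun p := polyInner b p q
  map_add' p r := polyInner_add_left hb p r q
  map_smul' c p := polyInner_smul_left b c p q

theorem polyInner_sub_left {b : ℂ} (hb : -1 / 2 < b.re) (p q r : ℂ[X]) :
    polyInner b (p - q) r = polyInner b p r - polyInner b q r :=
  map_sub (polyInnerLeft hb r) p q

theorem polyInner_add_right {b : ℂ} (hb : -1 / 2 < b.re) (p q r : ℂ[X]) :
    polyInner b p (q + r) = polyInner b p q + polyInner b p r := by
  rw [← polyInner_conj_symm, polyInner_add_left hb, map_add, polyInner_conj_symm,
    polyInner_conj_symm]

theorem polyInner_smul_right (b c : ℂ) (p q : ℂ[X]) :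
    polyInner b p (c • q) = conj c * polyInner b p q := by
  rw [← polyInner_conj_symm, polyInner_smul_left, map_mul, polyInner_conj_symm]

/-- The integrand |p|² w is nonnegative and vanishes inside (0, 2π) only at the finitely many angles
of roots of p. -/
theorem exists_pos_polyInner_self {b : ℂ} (hb : -1 / 2 < b.re) {p : ℂ[X]} (hp : p ≠ 0) :
    ∃ r : ℝ, 0 < r ∧ polyInner b p p = r := by
  refine ⟨∫ θ in (0 : ℝ)..2 * Real.pi, ‖p.eval (circleMap 0 1 θ)‖ ^ 2 * angularWeight b θ, ?_, ?_⟩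
  · have hint : IntervalIntegrable
        (fun θ ↦ ‖p.eval (circleMap 0 1 θ)‖ ^ 2 * angularWeight b θ) MeasureTheory.volume
        0 (2 * Real.pi) := by
      refine (intervalIntegrable_angularWeight hb).continuousOn_mul (Continuous.continuousOn ?_)
      exact ((p.continuous.comp (continuous_circleMap 0 1)).norm.pow 2)
    have hnonneg : 0 ≤ᵐ[MeasureTheory.volume.restrict (Set.uIoc 0 (2 * Real.pi))]
        fun θ ↦ ‖p.eval (circleMap 0 1 θ)‖ ^ 2 * angularWeight b θ := by
      rw [Set.uIoc_of_le Real.two_pi_pos.le, ← MeasureTheory.restrict_Ioo_eq_restrict_Ioc]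
      filter_upwards [MeasureTheory.ae_restrict_mem measurableSet_Ioo] with θ hθ
      exact mul_nonneg (by positivity) (angularWeight_pos b hθ).le
    rw [intervalIntegral.integral_pos_iff_support_of_nonneg_ae' hnonneg hint]
    refine ⟨Real.two_pi_pos, ?_⟩
    have hinj : Set.InjOn (circleMap 0 1) (Set.Ioc 0 (2 * Real.pi)) := by
      rw [← Set.uIoc_of_le Real.two_pi_pos.le]
      exact injOn_circleMap_of_abs_sub_le one_ne_zero
        (by rw [zero_sub, abs_neg, abs_of_pos Real.two_pi_pos])
    have hfin : {θ ∈ Set.Ioc 0 (2 * Real.pi) | p.eval (circleMap 0 1 θ) = 0}.Finite := by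
      refine Set.Finite.of_finite_image (f := circleMap 0 1) ?_ (hinj.mono fun x hx ↦ hx.1)
      refine (p.rootSet_finite ℂ).subset ?_
      rintro _ ⟨θ, hθ, rfl⟩
      rw [mem_rootSet_of_ne hp]
      simpa using hθ.2
    have hpos : 0 < MeasureTheory.volume (Set.Ioo 0 (2 * Real.pi) \
        {θ ∈ Set.Ioc 0 (2 * Real.pi) | p.eval (circleMap 0 1 θ) = 0}) := by
      rw [MeasureTheory.measure_sdiff_null (hfin.measure_zero _)]
      simp [Real.pi_pos]
    refine hpos.trans_le (MeasureTheory.measure_mono ?_)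
    rintro θ ⟨hθ, hθ'⟩
    have hθ'' : θ ∈ Set.Ioc 0 (2 * Real.pi) := ⟨hθ.1, hθ.2.le⟩
    refine ⟨?_, hθ''⟩
    have hne : p.eval (circleMap 0 1 θ) ≠ 0 := fun h ↦ hθ' ⟨hθ'', h⟩
    exact mul_ne_zero (pow_ne_zero _ (norm_ne_zero_iff.2 hne)) (angularWeight_pos b hθ).ne'
  · rw [polyInner, weightedIntegral, ← intervalIntegral.integral_ofReal]
    simp [Complex.mul_conj, Complex.normSq_eq_norm_sq]

theorem eq_zero_of_polyInner_self {b : ℂ} (hb : -1 / 2 < b.re) {p : ℂ[X]}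
    (hp : polyInner b p p = 0) : p = 0 := by
  by_contra h
  obtain ⟨r, hr, hpr⟩ := exists_pos_polyInner_self hb h
  rw [hp] at hpr
  exact hr.ne (by exact_mod_cast hpr)

theorem degree_sub_smul_lt {p q : ℂ[X]} {n : ℕ} (hp : p.Monic) (hpn : p.natDegree = n)
    (hq : q.degree < (n + 1 : ℕ)) : (q - q.coeff n • p).degree < n := by
  rw [degree_lt_iff_coeff_zero] at hq ⊢
  intro m hm
  rcases hm.eq_or_lt with rfl | hm
  · have : p.coeff n = 1 := by rw [← hpn]; exact hp.coeff_natDegree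
    simp [this]
  · have hz : p.coeff m = 0 := coeff_eq_zero_of_natDegree_lt (by omega)
    simp [hq m hm, hz]

/-- A polynomial orthogonal to monic polynomials of every degree `< n` is orthogonal to all
polynomials of degree `< n`. -/
theorem polyInner_eq_zero_of_monic {b : ℂ} (hb : -1 / 2 < b.re) {Φ : ℕ → ℂ[X]} {n : ℕ}
    (hm : ∀ k < n, (Φ k).Monic) (hd : ∀ k < n, (Φ k).natDegree = k) {p : ℂ[X]}
    (ho : ∀ k < n, polyInner b p (Φ k) = 0) {q : ℂ[X]} (hq : q.degree < n) :
    polyInner b p q = 0 := by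
  suffices ∀ N ≤ n, ∀ q : ℂ[X], q.degree < N → polyInner b p q = 0 from this n le_rfl q hq
  intro N
  induction N with
  | zero =>
    intro _ q hq
    have : q = 0 := by
      rw [← degree_eq_bot]
      exact Nat.WithBot.lt_zero_iff.1 (by simpa using hq)
    rw [this, polyInner]
    simp [weightedIntegral]
  | succ N ih =>
    intro hN q hq
    have h := ih (by omega) _ (degree_sub_smul_lt (hm N (by omega)) (hd N (by omega)) hq)
    rw [← sub_add_cancel q (q.coeff N • Φ N), polyInner_add_right hb, h, polyInner_smul_right,
      ho N (by omega)]
    simp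

theorem IsMonicOrthogonalSequence.polyInner_eq_zero {b : ℂ} (hb : -1 / 2 < b.re)
    {Φ : ℕ → ℂ[X]} (h : IsMonicOrthogonalSequence (jacobiWeight b) Φ) {n : ℕ} {q : ℂ[X]}
    (hq : q.degree < n) : polyInner b (Φ n) q = 0 := by
  refine polyInner_eq_zero_of_monic hb (fun k _ ↦ h.monic k) (fun k _ ↦ h.natDegree_eq k)
    (fun k hk ↦ ?_) hq
  obtain ⟨κ, -, ho⟩ := h.orthogonal
  rw [← circleIntegral_eq_polyInner, ho, if_neg hk.ne']

theorem eq_of_orthogonal {b : ℂ} (hb : -1 / 2 < b.re) {n : ℕ} {p q : ℂ[X]}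
    (hp : p.Monic) (hq : q.Monic) (hpn : p.natDegree = n) (hqn : q.natDegree = n)
    (hpo : ∀ r : ℂ[X], r.degree < n → polyInner b p r = 0)
    (hqo : ∀ r : ℂ[X], r.degree < n → polyInner b q r = 0) : p = q := by
  have hdeg : (p - q).degree < n := by
    have hc : p.coeff n = 1 := by rw [← hpn]; exact hp.coeff_natDegree
    have := degree_sub_smul_lt hq hqn (q := p)
      (by rw [degree_eq_natDegree hp.ne_zero, hpn]; exact_mod_cast n.lt_succ_self)
    rwa [hc, one_smul] at this
  rw [← sub_eq_zero]
  apply eq_zero_of_polyInner_self hb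
  rw [polyInner_sub_left hb, hpo _ hdeg, hqo _ hdeg, sub_zero]

/-- On polynomials of degree < n the map to the moments ⟨p, z^j⟩, j < n, is injective by
definiteness, hence bijective by dimension. Some q thus has the moments of z^n, and z^n - q is the
required polynomial. -/
theorem exists_monic_orthogonal {b : ℂ} (hb : -1 / 2 < b.re) (n : ℕ) :
    ∃ p : ℂ[X], p.Monic ∧ p.natDegree = n ∧
      ∀ q : ℂ[X], q.degree < n → polyInner b p q = 0 := by
  let T : degreeLT ℂ n →ₗ[ℂ] (Fin n → ℂ) :=
    LinearMap.pi fun j ↦ (polyInnerLeft hb (X ^ (j : ℕ))).comp (degreeLT ℂ n).subtype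
  have span {p : ℂ[X]} (hp : ∀ j < n, polyInner b p (X ^ j) = 0) {q : ℂ[X]}
      (hq : q.degree < n) : polyInner b p q = 0 :=
    polyInner_eq_zero_of_monic hb (fun k _ ↦ monic_X_pow k) (fun k _ ↦ natDegree_X_pow k) hp hq
  have hinj : Function.Injective T := by
    rw [injective_iff_map_eq_zero]
    rintro ⟨p, hp⟩ h
    rw [Submodule.mk_eq_zero]
    refine eq_zero_of_polyInner_self hb (span (fun j hj ↦ ?_) (mem_degreeLT.1 hp))
    exact congrFun h ⟨j, hj⟩
  have : FiniteDimensional ℂ (degreeLT ℂ n) := (degreeLTEquiv ℂ n).symm.finiteDimensional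
  have hsurj := (LinearMap.injective_iff_surjective_of_finrank_eq_finrank
    (degreeLTEquiv ℂ n).finrank_eq).1 hinj
  obtain ⟨⟨q, hq⟩, hTq⟩ := hsurj fun j ↦ polyInner b (X ^ n) (X ^ (j : ℕ))
  rw [mem_degreeLT] at hq
  refine ⟨X ^ n - q, (monic_X_pow n).sub_of_left (by rwa [degree_X_pow]), ?_, fun r hr ↦ span (fun j hj ↦ ?_) hr⟩
  · rw [natDegree_eq_of_degree_eq (degree_sub_eq_left_of_degree_lt (by rwa [degree_X_pow])),
      natDegree_X_pow]
  · rw [polyInner_sub_left hb, sub_eq_zero]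
    exact (congrFun hTq ⟨j, hj⟩).symm

theorem existsUnique_isMonicOrthogonalSequence {b : ℂ} (hb : -1 / 2 < b.re) :
    ∃! Φ : ℕ → ℂ[X], IsMonicOrthogonalSequence (jacobiWeight b) Φ := by
  choose Φ hm hd ho using exists_monic_orthogonal hb
  have hdeg (n : ℕ) : (Φ n).degree = n := by rw [degree_eq_natDegree (hm n).ne_zero, hd]
  refine ⟨Φ, ⟨hm, hd, ?_⟩, fun Ψ hΨ ↦ funext fun n ↦ ?_⟩
  · choose r hr hpr using fun n ↦ exists_pos_polyInner_self hb (hm n).ne_zero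
    refine ⟨fun n ↦ (Real.sqrt (r n))⁻¹, fun n ↦ inv_pos.2 (Real.sqrt_pos.2 (hr n)), ?_⟩
    intro n m
    rw [circleIntegral_eq_polyInner]
    rcases lt_trichotomy n m with h | rfl | h
    · rw [if_neg h.ne, ← polyInner_conj_symm, ho m _ (by rw [hdeg]; exact_mod_cast h), map_zero]
    · rw [if_pos rfl, hpr, ← Complex.ofReal_pow, inv_pow, Real.sq_sqrt (hr n).le]
      simp
    · rw [if_neg h.ne', ho n _ (by rw [hdeg]; exact_mod_cast h)]
  · exact eq_of_orthogonal hb (hΨ.monic n) (hm n) (hΨ.natDegree_eq n) (hd n)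
      (fun _ ↦ hΨ.polyInner_eq_zero hb) (ho n)

/-! ### The hypergeometric operator on polynomials -/

/-- The polynomial differential operator `z(1-z) p'' + (α z + β) p' + γ p`. -/
def hypergeometricOp (α β γ : ℂ) (p : ℂ[X]) : ℂ[X] :=
  X * (1 - X) * derivative (derivative p) + (C α * X + C β) * derivative p + C γ * p

theorem eval_hypergeometricOp (α β γ : ℂ) (p : ℂ[X]) (z : ℂ) :
    (hypergeometricOp α β γ p).eval z = z * (1 - z) * (derivative (derivative p)).eval z +
      (α * z + β) * (derivative p).eval z + γ * p.eval z := by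
  simp [hypergeometricOp]

theorem coeff_hypergeometricOp (α β γ : ℂ) (p : ℂ[X]) (k : ℕ) :
    (hypergeometricOp α β γ p).coeff k =
      (k + 1) * (k + β) * p.coeff (k + 1) + (γ + α * k - k * (k - 1)) * p.coeff k := by
  have h : hypergeometricOp α β γ p = X * derivative (derivative p) -
      X * (X * derivative (derivative p)) + C α * (X * derivative p) + C β * derivative p +
      C γ * p := by
    rw [hypergeometricOp]; ring
  rw [h]
  simp only [coeff_add, coeff_sub, coeff_C_mul]
  rcases k with _ | _ | k
  · simp [coeff_derivative]
  · simp [coeff_derivative, coeff_X_mul]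
    ring
  · simp only [coeff_X_mul, coeff_derivative]
    push_cast
    ring

/-- The coefficient at z^n cancels: n(1 + b) + n(n - b - 2) - n(n - 1) = 0. -/
theorem degree_hypergeometricOp_lt {b : ℂ} {n : ℕ} {p : ℂ[X]} (hp : p.natDegree = n) :
    (hypergeometricOp (n - b - 2) (1 - n - conj b) (n * (1 + b)) p).degree < n := by
  rw [degree_lt_iff_coeff_zero]
  intro m hm
  rw [coeff_hypergeometricOp, coeff_eq_zero_of_natDegree_lt (by omega : p.natDegree < m + 1)]
  rcases hm.eq_or_lt with rfl | hm
  · ring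
  · rw [coeff_eq_zero_of_natDegree_lt (by omega)]
    ring

/-- Orthogonality to lower degrees is inherited by the image under the differential operator. -/
theorem polyInner_hypergeometricOp_eq_zero {b : ℂ} (hb : -1 / 2 < b.re) {n : ℕ} {p : ℂ[X]}
    (ho : ∀ j < n, polyInner b p (X ^ j) = 0) {j : ℕ} (hj : j < n) :
    polyInner b (hypergeometricOp (n - b - 2) (1 - n - conj b) (n * (1 + b)) p) (X ^ j) = 0 := by
  -- In the Pearson identity for (z p' - c p) / z^(j+1), the p' term depends on j only through c +
  -- j. The value n - 1 of this sum produces the operator, plus multiples of ⟨p, z^j⟩ and ⟨p,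
  -- z^(j+1)⟩.
  set c : ℂ := n - 1 - j with hc
  have hps := weightedIntegral_pearson hb
    (h := fun z ↦ (z * (derivative p).eval z - c * p.eval z) / z ^ (j + 1))
    (h' := fun z ↦ ((derivative p).eval z + z * (derivative (derivative p)).eval z -
        c * (derivative p).eval z) / z ^ (j + 1) -
      (j + 1) * (z * (derivative p).eval z - c * p.eval z) / z ^ (j + 2)) ?_ ?_
  · rw [weightedIntegral_congr b (g := fun z ↦
      1 * ((hypergeometricOp (n - b - 2) (1 - n - conj b) (n * (1 + b)) p).eval z *
        conj ((X ^ j : ℂ[X]).eval z)) +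
      -(c * (j - b) + n * (1 + b)) * (p.eval z * conj ((X ^ j : ℂ[X]).eval z)) +
        c * (j + 1 + conj b) * (p.eval z * conj ((X ^ (j + 1) : ℂ[X]).eval z))),
      weightedIntegral_const_mul_add_add hb _ _ _ (continuousOn_eval_mul_conj_eval _ _ _)
        (continuousOn_eval_mul_conj_eval _ _ _) (continuousOn_eval_mul_conj_eval _ _ _)] at hps
    · change 1 * polyInner b _ (X ^ j) + _ * polyInner b p (X ^ j) +
        _ * polyInner b p (X ^ (j + 1)) = 0 at hps
      -- Orthogonality to z^(j+1) is unavailable when j + 1 = n, but then c = 0.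
      have hlast : c * (j + 1 + conj b) * polyInner b p (X ^ (j + 1)) = 0 := by
        rcases Nat.lt_or_ge (j + 1) n with h | h
        · rw [ho _ h, mul_zero]
        · have : c = 0 := by
            rw [hc, show n = j + 1 by omega]
            push_cast
            ring
          rw [this]
          simp
      rwa [ho j hj, hlast, mul_zero, add_zero, add_zero, one_mul] at hps
    · intro z hz
      have hz0 := ne_zero_of_mem_unitSphere hz
      simp only [eval_hypergeometricOp, eval_pow, eval_X, map_pow,
        conj_eq_inv_of_mem_unitSphere hz, inv_pow, hc]
      field_simp
      ring
  · intro z hz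
    have hz0 := ne_zero_of_mem_unitSphere hz
    have h1 := (((hasDerivAt_id z).mul ((derivative p).hasDerivAt z)).sub
      ((p.hasDerivAt z).const_mul c)).div (hasDerivAt_pow (j + 1) z) (pow_ne_zero _ hz0)
    refine h1.congr_deriv ?_
    simp
    field_simp
    ring
  · have (m : ℕ) : ∀ z ∈ Metric.sphere (0 : ℂ) 1, z ^ m ≠ 0 :=
      fun z hz ↦ pow_ne_zero _ (ne_zero_of_mem_unitSphere hz)
    exact (ContinuousOn.div (by fun_prop) (by fun_prop) (this _)).sub
      (ContinuousOn.div (by fun_prop) (by fun_prop) (this _))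

theorem IsMonicOrthogonalSequence.hypergeometricOp_eq_zero {b : ℂ} (hb : -1 / 2 < b.re)
    {Φ : ℕ → ℂ[X]} (h : IsMonicOrthogonalSequence (jacobiWeight b) Φ) (n : ℕ) :
    hypergeometricOp (n - b - 2) (1 - n - conj b) (n * (1 + b)) (Φ n) = 0 := by
  refine eq_zero_of_polyInner_self hb (polyInner_eq_zero_of_monic hb (fun k _ ↦ monic_X_pow k)
    (fun k _ ↦ natDegree_X_pow k) (fun j hj ↦ ?_) (degree_hypergeometricOp_lt (h.natDegree_eq n)))
  refine polyInner_hypergeometricOp_eq_zero hb (fun k hk ↦ h.polyInner_eq_zero hb ?_) hj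
  rw [degree_X_pow]
  exact_mod_cast hk

/-- The reciprocal polynomial of a solution of the hypergeometric equation of degree `≤ N` solves
a hypergeometric equation. -/
theorem hypergeometricOp_reciprocalPoly {b : ℂ} {N : ℕ} {p : ℂ[X]} (hp : p.natDegree ≤ N)
    (h : hypergeometricOp (N - b - 2) (1 - N - conj b) (N * (1 + b)) p = 0) :
    hypergeometricOp (N - b - 1) (-N - conj b) (b * N) (reciprocalPoly N p) = 0 := by
  have hcoeff (i : ℕ) : (reciprocalPoly N p).coeff i = conj (p.coeff (revAt N i)) := by
    rw [reciprocalPoly, coeff_map, coeff_reflect]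
  have hgt (i : ℕ) (hi : N < i) : (reciprocalPoly N p).coeff i = 0 := by
    rw [hcoeff, revAt_eq_self_of_lt hi, coeff_eq_zero_of_natDegree_lt (by omega), map_zero]
  ext k
  rw [coeff_hypergeometricOp, coeff_zero]
  rcases lt_trichotomy k N with hk | rfl | hk
  -- The recurrence at k for the reversed coefficients is, up to sign, the conjugate of the original
  -- one at m = N - k - 1.
  · obtain ⟨m, rfl⟩ : ∃ m, N = k + 1 + m := ⟨N - (k + 1), by omega⟩
    have hrec := congrArg (fun q ↦ conj (q.coeff m)) h
    simp only [coeff_hypergeometricOp, coeff_zero, map_zero] at hrec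
    rw [hcoeff, hcoeff, revAt_le (by omega), revAt_le (by omega),
      show k + 1 + m - (k + 1) = m by omega, show k + 1 + m - k = m + 1 by omega]
    simp only [map_add, map_mul, map_sub, map_one, map_natCast, Complex.conj_conj,
      map_ofNat] at hrec
    push_cast at hrec ⊢
    linear_combination -hrec
  · rw [hgt _ (Nat.lt_succ_self _)]
    ring
  · rw [hgt _ hk, hgt _ (by omega)]
    ring

/-! ### Cauchy-type integrals -/

theorem abs_one_sub_norm_le_norm_sub {t : ℂ} (ht : t ∈ Metric.sphere (0 : ℂ) 1) (z : ℂ) :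
    |1 - ‖z‖| ≤ ‖t - z‖ := by
  have h := abs_norm_sub_norm_le t z
  rwa [mem_sphere_zero_iff_norm.1 ht] at h

theorem sub_ne_zero_of_mem_unitSphere {t z : ℂ} (ht : t ∈ Metric.sphere (0 : ℂ) 1)
    (hz : z ∉ Metric.sphere (0 : ℂ) 1) : t - z ≠ 0 :=
  sub_ne_zero.2 fun h ↦ hz (h ▸ ht)

theorem continuousOn_cauchyKernel {g : ℂ → ℂ} (hg : ContinuousOn g (Metric.sphere 0 1)) {z : ℂ}
    (hz : z ∉ Metric.sphere (0 : ℂ) 1) (k : ℕ) :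
    ContinuousOn (fun t ↦ g t * ((t - z) ^ k)⁻¹) (Metric.sphere 0 1) :=
  hg.mul (ContinuousOn.inv₀ (by fun_prop)
    fun _ ht ↦ pow_ne_zero _ (sub_ne_zero_of_mem_unitSphere ht hz))

/-- Differentiation of Cauchy-type integrals under the integral sign. -/
theorem hasDerivAt_weightedIntegral_cauchyKernel {b : ℂ} (hb : -1 / 2 < b.re) {g : ℂ → ℂ}
    (hg : ContinuousOn g (Metric.sphere 0 1)) {z : ℂ} (hz : z ∉ Metric.sphere (0 : ℂ) 1) (k : ℕ) :
    HasDerivAt (fun z ↦ weightedIntegral b fun t ↦ g t * ((t - z) ^ k)⁻¹)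
      (k * weightedIntegral b fun t ↦ g t * ((t - z) ^ (k + 1))⁻¹) z := by
  -- Half the distance from z to the circle: points of the δ-ball stay at distance at least δ from
  -- it, which bounds the kernel uniformly.
  set δ : ℝ := |1 - ‖z‖| / 2 with hδ
  have hδ0 : 0 < δ := by
    refine half_pos (abs_pos.2 (sub_ne_zero.2 fun h ↦ hz ?_))
    rw [mem_sphere_zero_iff_norm, h]
  have hball (x : ℂ) (hx : x ∈ Metric.ball z δ) : δ ≤ |1 - ‖x‖| := by
    have h1 : |‖z‖ - ‖x‖| < δ := by
      refine (abs_norm_sub_norm_le z x).trans_lt ?_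
      rwa [← dist_eq_norm, dist_comm]
    have h2 : |1 - ‖z‖| ≤ |1 - ‖x‖| + |‖z‖ - ‖x‖| := by
      rw [show 1 - ‖z‖ = (1 - ‖x‖) - (‖z‖ - ‖x‖) by ring]
      exact abs_sub _ _
    linarith
  have hnot (x : ℂ) (hx : x ∈ Metric.ball z δ) : x ∉ Metric.sphere (0 : ℂ) 1 := fun h ↦ by
    have := hball x hx
    rw [mem_sphere_zero_iff_norm.1 h] at this
    simp at this
    linarith
  have hint (x : ℂ) (hx : x ∈ Metric.ball z δ) (m : ℕ) :=
    intervalIntegrable_mul_angularWeight hb (continuousOn_cauchyKernel hg (hnot x hx) m)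
  have hmem : Metric.ball z δ ∈ nhds z := Metric.ball_mem_nhds z hδ0
  have hzb : z ∈ Metric.ball z δ := Metric.mem_ball_self hδ0
  have hF' : IntervalIntegrable (fun θ ↦ (k : ℂ) * (g (circleMap 0 1 θ) *
      ((circleMap 0 1 θ - z) ^ (k + 1))⁻¹ * angularWeight b θ)) MeasureTheory.volume
      0 (2 * Real.pi) := (hint z hzb (k + 1)).const_mul _
  have key := intervalIntegral.hasDerivAt_integral_of_dominated_loc_of_deriv_le
    (μ := MeasureTheory.volume) (a := 0) (b := 2 * Real.pi) (x₀ := z) (s := Metric.ball z δ)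
    (F := fun x θ ↦ g (circleMap 0 1 θ) * ((circleMap 0 1 θ - x) ^ k)⁻¹ * angularWeight b θ)
    (F' := fun x θ ↦ (k : ℂ) * (g (circleMap 0 1 θ) * ((circleMap 0 1 θ - x) ^ (k + 1))⁻¹ *
      angularWeight b θ))
    (bound := fun θ ↦ k * (δ ^ (k + 1))⁻¹ * ‖g (circleMap 0 1 θ) * angularWeight b θ‖)
    hmem
    (Filter.eventually_of_mem hmem fun x hx ↦ (hint x hx k).def'.aestronglyMeasurable)
    (hint z hzb k) hF'.def'.aestronglyMeasurable ?_
    ((intervalIntegrable_mul_angularWeight hb hg).norm.const_mul _) ?_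
  · have h := key.2
    rw [intervalIntegral.integral_const_mul] at h
    exact h
  · refine Filter.Eventually.of_forall fun θ _ x hx ↦ ?_
    have hle : δ ≤ ‖circleMap 0 1 θ - x‖ :=
      (hball x hx).trans (abs_one_sub_norm_le_norm_sub (circleMap_mem_unitSphere θ) x)
    simp only [norm_mul, norm_inv, norm_pow, Complex.norm_natCast]
    have hinv : (‖circleMap 0 1 θ - x‖ ^ (k + 1))⁻¹ ≤ (δ ^ (k + 1))⁻¹ := by gcongr
    calc _ = k * (‖circleMap 0 1 θ - x‖ ^ (k + 1))⁻¹ *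
          (‖g (circleMap 0 1 θ)‖ * ‖(angularWeight b θ : ℂ)‖) := by ring
      _ ≤ _ := by gcongr
  · refine Filter.Eventually.of_forall fun θ _ x hx ↦ ?_
    have hne := sub_ne_zero_of_mem_unitSphere (circleMap_mem_unitSphere θ) (hnot x hx)
    have h1 := ((((hasDerivAt_id x).const_sub (circleMap 0 1 θ)).pow k).inv
      (pow_ne_zero k hne)).const_mul (g (circleMap 0 1 θ))
    refine (h1.mul_const (angularWeight b θ : ℂ)).congr_deriv ?_
    rcases k with _ | k
    · simp
    · simp only [id, Nat.add_sub_cancel, Pi.pow_apply]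
      field_simp
      ring

theorem associatedFunction_eq (b : ℂ) (n : ℕ) (p : ℂ[X]) :
    associatedFunction (jacobiWeight b) n p = fun z ↦ (2 * (Real.pi : ℂ) * Complex.I)⁻¹ *
      weightedIntegral b fun t ↦ Complex.I * t * p.eval t / t ^ n * ((t - z) ^ 1)⁻¹ := by
  ext z
  have h : ∀ t, p.eval t / (t - z) * (jacobiWeight b t / t ^ n) =
      p.eval t / (t - z) / t ^ n * jacobiWeight b t := fun t ↦ by ring
  simp_rw [associatedFunction, h]
  rw [circleIntegral_mul_jacobiWeight]
  congr 2
  ext t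
  ring

theorem continuousOn_mul_eval_div_pow (n : ℕ) (p : ℂ[X]) :
    ContinuousOn (fun t ↦ Complex.I * t * p.eval t / t ^ n) (Metric.sphere 0 1) :=
  ContinuousOn.div (by fun_prop) (by fun_prop)
    fun _ ht ↦ pow_ne_zero _ (ne_zero_of_mem_unitSphere ht)

/-- If `p` solves a hypergeometric equation, then the kernel of its Cauchy-type integral,
hit with the corresponding operator, is a total derivative and integrates to zero. -/
theorem weightedIntegral_hypergeometric_cauchyKernel {b : ℂ} (hb : -1 / 2 < b.re) {n : ℕ}
    {γ : ℂ} {p : ℂ[X]} (hp : hypergeometricOp (n - b - 2) (1 - n - conj b) γ p = 0) {z : ℂ}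
    (hz : z ∉ Metric.sphere (0 : ℂ) 1) :
    weightedIntegral b (fun t ↦ Complex.I * t * p.eval t / t ^ n *
      (z * (1 - z) * (2 * ((t - z) ^ 3)⁻¹) + ((b - n - 2) * z + (1 + n + conj b)) *
        ((t - z) ^ 2)⁻¹ + (γ + b - n) * ((t - z) ^ 1)⁻¹)) = 0 := by
  -- With K = 1/(t - z), this h is -t^(1-n) (K p' - K' p), primes being t-derivatives: the Wronskian
  -- of the Lagrange identity that moves the operator from p to K.
  have hps := weightedIntegral_pearson hb
    (h := fun t ↦ -(t * (p.eval t + (t - z) * (derivative p).eval t)) / (t ^ n * (t - z) ^ 2))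
    (h' := fun t ↦
      -(p.eval t + (t - z) * (derivative p).eval t +
        t * (2 * (derivative p).eval t + (t - z) * (derivative (derivative p)).eval t)) /
          (t ^ n * (t - z) ^ 2) +
      t * (p.eval t + (t - z) * (derivative p).eval t) *
        (n / (t ^ (n + 1) * (t - z) ^ 2) + 2 / (t ^ n * (t - z) ^ 3))) ?_ ?_
  · rw [← mul_zero Complex.I, ← hps, ← weightedIntegral_const_mul]
    refine weightedIntegral_congr b fun t ht ↦ ?_
    have ht0 := ne_zero_of_mem_unitSphere ht
    have htz := sub_ne_zero_of_mem_unitSphere ht hz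
    have hE := congrArg (eval t) hp
    rw [eval_hypergeometricOp, eval_zero] at hE
    rw [← sub_eq_zero]
    -- The integrand minus i times the Pearson expression is exactly this multiple of the equation
    -- of p at t.
    refine Eq.trans ?_ (mul_eq_zero_of_right (Complex.I * t / (t ^ n * (t - z))) hE)
    field_simp
    ring
  · intro t ht
    have ht0 := ne_zero_of_mem_unitSphere ht
    have htz := sub_ne_zero_of_mem_unitSphere ht hz
    have hs := (hasDerivAt_id t).sub_const z
    have h1 := (((hasDerivAt_id t).mul ((p.hasDerivAt t).add
      (hs.mul ((derivative p).hasDerivAt t)))).neg).div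
      ((hasDerivAt_pow n t).mul (hs.pow 2))
      (mul_ne_zero (pow_ne_zero n ht0) (pow_ne_zero 2 htz))
    refine h1.congr_deriv ?_
    rcases n with _ | n
    · simp
      field_simp
      ring
    · simp
      field_simp
      ring
  · have h0 (m : ℕ) : ∀ t ∈ Metric.sphere (0 : ℂ) 1, t ^ m ≠ 0 :=
      fun t ht ↦ pow_ne_zero _ (ne_zero_of_mem_unitSphere ht)
    have h1 (k m : ℕ) : ∀ t ∈ Metric.sphere (0 : ℂ) 1, t ^ k * (t - z) ^ m ≠ 0 :=
      fun t ht ↦ mul_ne_zero (h0 k t ht) (pow_ne_zero _ (sub_ne_zero_of_mem_unitSphere ht hz))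
    refine ContinuousOn.add (ContinuousOn.div (by fun_prop) (by fun_prop) (h1 _ _)) ?_
    refine ContinuousOn.mul (by fun_prop) (ContinuousOn.add ?_ ?_)
    · exact ContinuousOn.div (by fun_prop) (by fun_prop) (h1 _ _)
    · exact ContinuousOn.div (by fun_prop) (by fun_prop) (h1 _ _)

/-- The parameter γ is left free because Φ_n and the reciprocal polynomial of Φ_(n-1) satisfy
equations differing only in γ: the values n(1 + b) and b(n - 1) become b(1 + n) and n(b - 1) under γ
↦ γ + b - n. -/
theorem associatedFunction_hypergeometric {b : ℂ} (hb : -1 / 2 < b.re) {n : ℕ} {γ : ℂ} {p : ℂ[X]}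
    (hp : hypergeometricOp (n - b - 2) (1 - n - conj b) γ p = 0) :
    DifferentiableOn ℂ (associatedFunction (jacobiWeight b) n p) (Metric.sphere 0 1)ᶜ ∧
    ∀ z ∉ Metric.sphere (0 : ℂ) 1,
      z * (1 - z) * deriv (deriv (associatedFunction (jacobiWeight b) n p)) z
        + ((b - n - 2) * z + (1 + n + conj b)) * deriv (associatedFunction (jacobiWeight b) n p) z
        + (γ + b - n) * associatedFunction (jacobiWeight b) n p z = 0 := by
  have hg := continuousOn_mul_eval_div_pow n p
  have hd1 (z : ℂ) (hz : z ∉ Metric.sphere (0 : ℂ) 1) :=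
    (hasDerivAt_weightedIntegral_cauchyKernel hb hg hz 1).const_mul
      (2 * (Real.pi : ℂ) * Complex.I)⁻¹
  have hd2 (z : ℂ) (hz : z ∉ Metric.sphere (0 : ℂ) 1) :=
    ((hasDerivAt_weightedIntegral_cauchyKernel hb hg hz 2).const_mul ((1 : ℕ) : ℂ)).const_mul
      (2 * (Real.pi : ℂ) * Complex.I)⁻¹
  rw [associatedFunction_eq]
  refine ⟨fun z hz ↦ (hd1 z hz).differentiableAt.differentiableWithinAt, fun z hz ↦ ?_⟩
  have hopen : (Metric.sphere (0 : ℂ) 1)ᶜ ∈ nhds z := Metric.isClosed_sphere.isOpen_compl.mem_nhds hz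
  have hev := Filter.eventually_of_mem hopen fun x hx ↦ (hd1 x hx).deriv
  rw [Filter.EventuallyEq.deriv_eq hev, (hd2 z hz).deriv, (hd1 z hz).deriv]
  have hcont (k : ℕ) := continuousOn_cauchyKernel hg hz k
  have hzero := weightedIntegral_hypergeometric_cauchyKernel hb hp hz
  rw [weightedIntegral_congr b (g := fun t ↦
    2 * (z * (1 - z)) * (Complex.I * t * p.eval t / t ^ n * ((t - z) ^ 3)⁻¹) +
    ((b - n - 2) * z + (1 + n + conj b)) *
      (Complex.I * t * p.eval t / t ^ n * ((t - z) ^ 2)⁻¹) +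
    (γ + b - n) * (Complex.I * t * p.eval t / t ^ n * ((t - z) ^ 1)⁻¹))
    (fun t _ ↦ by ring),
    weightedIntegral_const_mul_add_add hb _ _ _ (hcont 3) (hcont 2) (hcont 1)] at hzero
  push_cast
  linear_combination (2 * (Real.pi : ℂ) * Complex.I)⁻¹ * hzero

end

theorem mainTheorem12 (b : ℂ) (hb : -1 / 2 < b.re) :
    (∃! Φ : ℕ → ℂ[X], IsMonicOrthogonalSequence (jacobiWeight b) Φ) ∧
    ∀ Φ : ℕ → ℂ[X], IsMonicOrthogonalSequence (jacobiWeight b) Φ →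
    ∀ n : ℕ, 1 ≤ n →
    ∀ Φs : ℂ[X], Φs = reciprocalPoly (n - 1) (Φ (n - 1)) →
    ∀ G Gs : ℂ → ℂ, G = associatedFunction (jacobiWeight b) n (Φ n) →
      Gs = associatedFunction (jacobiWeight b) n Φs →
    (∀ z : ℂ,
      z * (1 - z) * (derivative (derivative (Φ n))).eval z
        + ((n - b - 2) * z + (1 - n - conj b)) * (derivative (Φ n)).eval z
        + n * (1 + b) * (Φ n).eval z = 0) ∧
    (DifferentiableOn ℂ G (Metric.sphere 0 1)ᶜ ∧
      ∀ z ∉ Metric.sphere (0 : ℂ) 1,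
        z * (1 - z) * deriv (deriv G) z
          + ((b - n - 2) * z + (1 + n + conj b)) * deriv G z
          + b * (1 + n) * G z = 0) ∧
    (∀ z : ℂ,
      z * (1 - z) * (derivative (derivative Φs)).eval z
        + ((n - b - 2) * z + (1 - n - conj b)) * (derivative Φs).eval z
        + b * (n - 1) * Φs.eval z = 0) ∧
    (DifferentiableOn ℂ Gs (Metric.sphere 0 1)ᶜ ∧
      ∀ z ∉ Metric.sphere (0 : ℂ) 1,
        z * (1 - z) * deriv (deriv Gs) z
          + ((b - n - 2) * z + (1 + n + conj b)) * deriv Gs z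
          + n * (b - 1) * Gs z = 0) := by
  refine ⟨existsUnique_isMonicOrthogonalSequence hb, ?_⟩
  rintro Φ h n hn Φs rfl G Gs rfl rfl
  obtain ⟨N, rfl⟩ : ∃ N, n = N + 1 := ⟨n - 1, by omega⟩
  rw [Nat.add_sub_cancel]
  have h1 := h.hypergeometricOp_eq_zero hb (N + 1)
  have h3 : hypergeometricOp (((N + 1 : ℕ) : ℂ) - b - 2) (1 - ((N + 1 : ℕ) : ℂ) - conj b)
      (b * (((N + 1 : ℕ) : ℂ) - 1)) (reciprocalPoly N (Φ N)) = 0 := by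
    convert hypergeometricOp_reciprocalPoly (h.natDegree_eq N).le
      (h.hypergeometricOp_eq_zero hb N) using 2 <;> push_cast <;> ring
  have h2 := associatedFunction_hypergeometric hb h1
  have h4 := associatedFunction_hypergeometric hb h3
  refine ⟨fun z ↦ ?_, ⟨h2.1, fun z hz ↦ ?_⟩, fun z ↦ ?_, ⟨h4.1, fun z hz ↦ ?_⟩⟩
  · rw [← eval_hypergeometricOp, h1, eval_zero]
  · linear_combination h2.2 z hz
  · rw [← eval_hypergeometricOp, h3, eval_zero]
  · linear_combination h4.2 z hz
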